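/- For integers $\ell\ge 1$ and $n\ge 0$, let $\overline{R_\ell^\ast}(n)$ denote the number of overpartitions of $n$ (partitions of $n$ in which the first occurrence of each part size may be overlined) whose non-overlined parts are $\ell$-regular, i.e. none of the non-overlined parts is divisible by $\ell$. Then for all $n\ge 0$, \begin{align*} \overline{R_8^\ast}(16n+9)&\equiv 0 \pmod{8},\\ \overline{R_8^\ast}(16n+11)&\equiv 0 \pmod{16},\\ \overline{R_8^\ast}(32n+25)&\equiv 0 \pmod{16},\\ \overline{R_8^\ast}(64n+37)&\equiv 0 \pmod{32},\\ \overline{R_8^\ast}(16n+13)&\equiv 0 \pmod{64},\\ \overline{R_8^\ast}(32n+21)&\equiv 0 \pmod{64},\\ \overline{R_8^\ast}(16n+15)&\equiv 0 \pmod{128},\\ \overline{R_8^\ast}(32n+29)&\equiv 0 \pmod{256},\\ \overline{R_8^\ast}(128n+85)&\equiv 0 \pmod{512},\\ \overline{R_8^\ast}(64n+53)&\equiv 0 \pmod{1024},\\ \overline{R_8^\ast}(128n+117)&\equiv 0 \pmod{4096}. \end{align*} -/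

import Mathlib

/-- An overpartition of `n`: a partition of `n` in which the first occurrence of each part size may
be overlined.  It is recorded by the underlying partition together with the set of those part sizes
whose first occurrence is overlined. -/
@[ext]
structure Overpartition (n : ℕ) where
  /-- the underlying partition of `n` (overlines forgotten) -/
  toPartition : n.Partition
  /-- the part sizes whose first occurrence is overlined -/
  overlined : Finset ℕ
  /-- only sizes that occur as parts can be overlined -/
  overlined_subset : overlined ⊆ toPartition.parts.toFinset

namespace Overpartition

/-- The multiset of the non-overlined parts: all the parts, with one occurrence removed of each
overlined size. -/
def nonOverlinedParts {n : ℕ} (π : Overpartition n) : Multiset ℕ :=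
  π.toPartition.parts - π.overlined.val

/-- An overpartition is a partition together with a subset of its set of part sizes. -/
def equivSigma (n : ℕ) :
    (Σ p : n.Partition, {s : Finset ℕ // s ∈ p.parts.toFinset.powerset}) ≃ Overpartition n where
  toFun x := ⟨x.1, x.2.1, Finset.mem_powerset.mp x.2.2⟩
  invFun π := ⟨π.toPartition, π.overlined, Finset.mem_powerset.mpr π.overlined_subset⟩
  left_inv _ := rfl
  right_inv _ := rfl

instance (n : ℕ) : Fintype (Overpartition n) := Fintype.ofEquiv _ (equivSigma n)

/-- The non-overlined parts of `π` are `ℓ`-regular: none of them is divisible by `ℓ`. -/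
def NonOverlinedRegular (ℓ : ℕ) {n : ℕ} (π : Overpartition n) : Prop :=
  ∀ i ∈ π.nonOverlinedParts, ¬ ℓ ∣ i

instance (ℓ n : ℕ) : DecidablePred (NonOverlinedRegular ℓ (n := n)) := fun π =>
  inferInstanceAs (Decidable (∀ i ∈ π.nonOverlinedParts, ¬ ℓ ∣ i))

end Overpartition

/-- The number of overpartitions of `n` whose non-overlined parts are `ℓ`-regular. -/
def overlineRStar (ℓ n : ℕ) : ℕ :=
  Fintype.card {π : Overpartition n // π.NonOverlinedRegular ℓ}

open PowerSeries Finset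
open scoped PowerSeries.WithPiTopology
open PowerSeries.WithPiTopology

/-! ### Generating function as an Euler product. -/

namespace Overpartition

/-! Write `f_k = ∏ (1 - q^(kn))` and `W = f₂ / f₁²`. Comparing Euler factors shows that the
generating function is `W f₈` (`regularSeries_mul_sq`, `regularSeries_eight`). Iterating `W(q) =
φ(q) W(q²)²` (`overSeries_eq`) gives `W = φ(q) φ(q²)² φ(q⁴)⁴ W(q⁸)⁸`, so arithmetic progressions can
be extracted by dissecting theta functions.

Set `A = φ²` and `B = ψ(q²)²`. The dissections run on `A(q) = A(q²) + 4q B(q²)` and `B(q)² = A(q²)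
B(q²)` (`phiSq_eq`, `psiTwoSq_sq`), together with `W² = A W(q²)⁴` and `f₂ ψ(q²) = f₄²`. Each
extracted series is then an explicit power of 2 times a product of Euler products, powers of `W` and
`ψ`, and a polynomial in `q, A, B`.

The remaining powers of 2 come from `φ ≡ W ≡ 1 (mod 2)`, hence `φ^(2^k) ≡ W^(2^k) ≡ 1 (mod
2^(k+1))`, and from `f₁² ≡ f₂`, `ψ² ≡ ψ(q²) (mod 2)`. Modulo a suitable power of 2 the cofactor,
possibly after one more dissection, is a series in `q²`, so its odd coefficients vanish
(`dvd_coeff_two_mul_add_one`). -/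

/-- The number of ways to overline at most one of `c` copies of the part `i`
so that no non-overlined copy is divisible by `ℓ`. -/
def regularWeight (ℓ i c : ℕ) : ℤ :=
  (if ℓ ∣ i ∧ c ≠ 1 then 0 else 1) + (if ℓ ∣ i then 0 else 1)

/-- An overlined size leaves a non-overlined copy exactly when its multiplicity is not 1. Separating
the sizes this way lets the count factor over them. -/
theorem nonOverlinedRegular_iff {ℓ n : ℕ} (π : Overpartition n) :
    π.NonOverlinedRegular ℓ ↔
      (∀ i ∈ π.overlined, ¬ (ℓ ∣ i ∧ π.toPartition.parts.count i ≠ 1)) ∧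
      ∀ i ∈ π.toPartition.parts.toFinset \ π.overlined, ¬ ℓ ∣ i := by
  have hsub := π.overlined_subset
  have hmem : ∀ i, i ∈ π.nonOverlinedParts ↔
      π.overlined.val.count i < π.toPartition.parts.count i := fun i => by
    rw [nonOverlinedParts, Multiset.mem_sub]
  have h1 : ∀ i ∈ π.overlined, π.overlined.val.count i = 1 := fun i hi =>
    Multiset.count_eq_one_of_mem π.overlined.nodup hi
  have h0 : ∀ i, i ∉ π.overlined → π.overlined.val.count i = 0 := fun i hi =>
    Multiset.count_eq_zero.2 hi
  have hpos : ∀ i, i ∈ π.toPartition.parts ↔ 0 < π.toPartition.parts.count i := fun i =>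
    Multiset.count_pos.symm
  simp only [NonOverlinedRegular, hmem]
  constructor
  · intro h
    refine ⟨fun i hi => ?_, fun i hi => ?_⟩
    · rintro ⟨hd, hc⟩
      have hp := (hpos i).1 (Multiset.mem_toFinset.1 (hsub hi))
      have := h1 i hi
      exact h i (by omega) hd
    · rw [Finset.mem_sdiff, Multiset.mem_toFinset, hpos] at hi
      exact h i (by rw [h0 i hi.2]; exact hi.1)
  · rintro ⟨ha, hb⟩ i hi hd
    by_cases hio : i ∈ π.overlined
    · rw [h1 i hio] at hi
      exact ha i hio ⟨hd, by omega⟩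
    · refine hb i ?_ hd
      rw [Finset.mem_sdiff, Multiset.mem_toFinset, hpos]
      exact ⟨by omega, hio⟩

/-- Expanding the product of two-term weights gives a sum over subsets of the part sizes, which are
the choices of overlined sizes. -/
theorem overlineRStar_eq_sum (ℓ n : ℕ) :
    (overlineRStar ℓ n : ℤ) =
      ∑ p : n.Partition, p.parts.toFinsupp.prod (regularWeight ℓ) := by
  have h1 : (overlineRStar ℓ n : ℤ) =
      ∑ π : Overpartition n, if π.NonOverlinedRegular ℓ then (1 : ℤ) else 0 := by
    rw [overlineRStar, Fintype.card_subtype, Finset.sum_boole]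
  rw [h1, ← Equiv.sum_comp (equivSigma n), Fintype.sum_sigma]
  refine Finset.sum_congr rfl fun p _ => ?_
  have hw : p.parts.toFinsupp.prod (regularWeight ℓ) = ∏ i ∈ p.parts.toFinset,
      ((if ¬ (ℓ ∣ i ∧ p.parts.count i ≠ 1) then (1 : ℤ) else 0) +
        (if ¬ ℓ ∣ i then 1 else 0)) := by
    rw [Finsupp.prod, Multiset.toFinsupp_support]
    refine Finset.prod_congr rfl fun i _ => ?_
    rw [Multiset.toFinsupp_apply, regularWeight, ite_not, ite_not]
  rw [hw, Finset.prod_add, ← Finset.sum_coe_sort p.parts.toFinset.powerset]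
  refine Finset.sum_congr rfl fun s _ => ?_
  rw [Finset.prod_boole, Finset.prod_boole, ite_zero_mul_ite_zero, mul_one]
  exact if_congr (nonOverlinedRegular_iff _) rfl rfl

/-- The generating function of `overlineRStar ℓ`. -/
noncomputable def regularSeries (ℓ : ℕ) : ℤ⟦X⟧ :=
  PowerSeries.mk fun n => (overlineRStar ℓ n : ℤ)

theorem regularSeries_eq_genFun (ℓ : ℕ) :
    regularSeries ℓ = Nat.Partition.genFun (regularWeight ℓ) := by
  ext n
  rw [Nat.Partition.coeff_genFun, regularSeries, coeff_mk, overlineRStar_eq_sum]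

/-- With `x = X ^ (i + 1)`, the local factor is `(1 + x) / (1 - x)` for an unrestricted size. It is
`1 + x` when `ℓ` divides the size, since then only a single overlined copy may occur. -/
theorem one_add_tsum_regularWeight_mul (ℓ i : ℕ) :
    (1 + ∑' j, C (regularWeight ℓ (i + 1) (j + 1)) * (X : ℤ⟦X⟧) ^ ((i + 1) * (j + 1))) *
      (1 - X ^ (i + 1)) =
      (1 + X ^ (i + 1)) * (if ℓ ∣ i + 1 then 1 - X ^ (i + 1) else 1) := by
  by_cases h : ℓ ∣ i + 1
  · have : (∑' j, C (regularWeight ℓ (i + 1) (j + 1)) * (X : ℤ⟦X⟧) ^ ((i + 1) * (j + 1))) =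
        X ^ (i + 1) := by
      rw [tsum_eq_single 0]
      · simp [regularWeight, h]
      · intro j hj
        simp [regularWeight, h, hj]
    rw [this, if_pos h]
  · have hs := one_sub_mul_tsum_pow_of_constantCoeff_eq_zero (R := ℤ)
      (f := X ^ (i + 1)) (by simp)
    have : (∑' j, C (regularWeight ℓ (i + 1) (j + 1)) * (X : ℤ⟦X⟧) ^ ((i + 1) * (j + 1))) =
        (∑' j, ((X : ℤ⟦X⟧) ^ (i + 1)) ^ j) * (2 * X ^ (i + 1)) := by
      rw [← Summable.tsum_mul_right]
      · refine tsum_congr fun j => ?_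
        simp only [regularWeight, h, false_and, if_false]
        rw [show C ((1 : ℤ) + 1) = (2 : ℤ⟦X⟧) by rw [map_add, map_one]; norm_num]
        ring
      · exact summable_pow_of_constantCoeff_eq_zero (by simp)
    rw [this, if_neg h]
    linear_combination (2 * X ^ (i + 1)) * hs

/-- The Euler product `∏ (1 - X ^ n)`. -/
noncomputable def eulerProd : ℤ⟦X⟧ := ∏' i : ℕ, (1 - X ^ (i + 1))

theorem hasProd_eulerProd : HasProd (fun i : ℕ => (1 : ℤ⟦X⟧) - X ^ (i + 1)) eulerProd :=
  (multipliable_one_sub_X_pow ℤ).hasProd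

theorem continuous_expand (k : ℕ) (hk : k ≠ 0) :
    Continuous (expand k hk : ℤ⟦X⟧ → ℤ⟦X⟧) := by
  rw [continuous_iff_continuousAt]
  intro f
  rw [ContinuousAt, WithPiTopology.tendsto_iff_coeff_tendsto]
  intro d
  simp only [coeff_expand]
  split_ifs
  · exact (WithPiTopology.continuous_coeff ℤ (d / k)).tendsto f
  · exact tendsto_const_nhds

theorem hasProd_expand_eulerProd (k : ℕ) (hk : k ≠ 0) :
    HasProd (fun i : ℕ => (1 : ℤ⟦X⟧) - X ^ (k * (i + 1))) (expand k hk eulerProd) := by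
  have := hasProd_eulerProd.map (expand k hk) (continuous_expand k hk)
  refine this.congr_fun fun i => ?_
  simp [pow_mul]

theorem hasProd_expand_eulerProd_dvd (k : ℕ) (hk : k ≠ 0) :
    HasProd (fun i : ℕ => if k ∣ i + 1 then (1 : ℤ⟦X⟧) - X ^ (i + 1) else 1)
      (expand k hk eulerProd) := by
  have hinj : Function.Injective fun i : ℕ => k * (i + 1) - 1 := by
    intro a b hab
    have h1 : 0 < k * (a + 1) := by positivity
    have h2 : 0 < k * (b + 1) := by positivity
    have : k * (a + 1) = k * (b + 1) := by simp only at hab; omega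
    simpa using Nat.eq_of_mul_eq_mul_left (Nat.pos_of_ne_zero hk) this
  rw [← hinj.hasProd_iff]
  · refine (hasProd_expand_eulerProd k hk).congr_fun fun i => ?_
    have h1 : k * (i + 1) - 1 + 1 = k * (i + 1) := Nat.sub_add_cancel (Nat.mul_pos (Nat.pos_of_ne_zero hk) i.succ_pos)
    simp [h1]
  · intro x hx
    rw [if_neg]
    rintro ⟨c, hc⟩
    refine hx ⟨c - 1, ?_⟩
    have : c ≠ 0 := by rintro rfl; simp at hc
    simp only
    rw [Nat.sub_add_cancel (by omega), ← hc]
    simp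

theorem regularSeries_mul_sq (ℓ : ℕ) (hℓ : ℓ ≠ 0) :
    regularSeries ℓ * eulerProd ^ 2 =
      expand 2 two_ne_zero eulerProd * expand ℓ hℓ eulerProd := by
  have h1 := ((Nat.Partition.hasProd_genFun (regularWeight ℓ)).mul hasProd_eulerProd).mul
    hasProd_eulerProd
  have h2 := (hasProd_expand_eulerProd 2 two_ne_zero).mul (hasProd_expand_eulerProd_dvd ℓ hℓ)
  simp only [smul_eq_C_mul] at h1
  rw [regularSeries_eq_genFun, sq, ← mul_assoc]
  refine h1.unique (h2.congr_fun fun i => ?_)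
  rw [one_add_tsum_regularWeight_mul]
  ring

/-! ### Shanks's finite identity. -/

/-- A finite form of Gauss's identity for triangular numbers (Shanks). -/
theorem prod_odd_mul_sum_pow_triangle {R : Type*} [CommRing R] (q : R) (n : ℕ) :
    (∏ k ∈ range n, (1 - q ^ (2 * k + 1))) *
        ∑ m ∈ range n, (q ^ (m * (2 * m + 1)) + q ^ ((m + 1) * (2 * m + 1))) =
      ∑ s ∈ range n, (∏ k ∈ range s, (1 - q ^ (2 * k + 1))) *
        (∏ k ∈ Ico s n, (1 - q ^ (2 * k + 2))) * q ^ (s * (2 * n + 1)) := by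
  induction n with
  | zero => simp
  | succ n ih =>
    set D : ℕ → R := fun s => ∏ k ∈ range s, (1 - q ^ (2 * k + 1)) with hD
    set N : ℕ → ℕ → R := fun s n => ∏ k ∈ Ico s n, (1 - q ^ (2 * k + 2)) with hN
    have hDs : ∀ s, D (s + 1) = D s * (1 - q ^ (2 * s + 1)) := fun s => prod_range_succ _ _
    have hNs : ∀ s, s ≤ n → N s (n + 1) = N s n * (1 - q ^ (2 * n + 2)) := fun s hs =>
      prod_Ico_succ_top hs _
    have hNb : ∀ s, s < n → N s n = (1 - q ^ (2 * s + 2)) * N (s + 1) n := fun s hs =>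
      prod_eq_prod_Ico_succ_bot hs _
    have hNn : N n n = 1 := by simp [hN]
    -- The change of the right-hand summand from `n` to `n + 1`, corrected by the new factor of `D`,
    -- telescopes in `s`.
    have htel : ∑ s ∈ range n, (D s * N s (n + 1) * q ^ (s * (2 * (n + 1) + 1)) -
        (1 - q ^ (2 * n + 1)) * (D s * N s n * q ^ (s * (2 * n + 1)))) =
        D n * (1 - q ^ (2 * n)) * q ^ (n * (2 * n + 1)) := by
      have := sum_range_sub
        (fun s => D s * N s n * (1 - q ^ (2 * s)) * q ^ (s * (2 * n + 1))) n
      simp only [hNn, mul_zero, pow_zero, sub_self, zero_mul, sub_zero, mul_one] at this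
      rw [← this]
      refine sum_congr rfl fun s hs => ?_
      have hs' := mem_range.1 hs
      rw [hNs s hs'.le, hNb s hs', hDs]
      ring
    rw [sum_sub_distrib, ← mul_sum, ← ih] at htel
    rw [sum_range_succ, sum_range_succ]
    change D (n + 1) * _ = ∑ s ∈ range n, D s * N s (n + 1) * _ + D n * N n (n + 1) * _
    rw [hDs, hNs n le_rfl, hNn]
    linear_combination -htel

/-! ### Series counting exponents. -/

/-- The generating function of the exponents `e i`. -/
noncomputable def expSeries {ι : Type*} (e : ι → ℕ) : ℤ⟦X⟧ :=
  PowerSeries.mk fun n => (Nat.card {i // e i = n} : ℤ)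

/-- This turns an exponent-preserving bijection of index sets into an identity of theta series. -/
theorem expSeries_comp_equiv {ι κ : Type*} (e : ι → ℕ) (f : κ ≃ ι) :
    expSeries (fun k => e (f k)) = expSeries e := by
  ext n
  simp only [expSeries, coeff_mk]
  exact congrArg _ (Nat.card_congr (f.subtypeEquiv fun _ => Iff.rfl))

theorem expSeries_sum {ι κ : Type*} (e : ι → ℕ) (f : κ → ℕ) [∀ n, Finite {i // e i = n}]
    [∀ n, Finite {i // f i = n}] :
    expSeries (Sum.elim e f) = expSeries e + expSeries f := by
  ext n
  simp only [expSeries, coeff_mk, map_add]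
  have h1 : Finite {a // Sum.elim e f (Sum.inl a) = n} := inferInstanceAs (Finite {i // e i = n})
  have h2 : Finite {b // Sum.elim e f (Sum.inr b) = n} := inferInstanceAs (Finite {i // f i = n})
  rw [Nat.card_congr Equiv.subtypeSum, Nat.card_sum]
  simp

theorem expSeries_prod {ι κ : Type*} (e : ι → ℕ) (f : κ → ℕ) [∀ n, Finite {i // e i = n}]
    [∀ n, Finite {i // f i = n}] :
    expSeries (fun p : ι × κ => e p.1 + f p.2) = expSeries e * expSeries f := by
  ext n
  simp only [expSeries, coeff_mk, coeff_mul]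
  let F : {p : ι × κ // e p.1 + f p.2 = n} ≃
      Σ d : antidiagonal n, {i // e i = d.1.1} × {i // f i = d.1.2} :=
    { toFun := fun p => ⟨⟨(e p.1.1, f p.1.2), mem_antidiagonal.2 p.2⟩, ⟨p.1.1, rfl⟩, ⟨p.1.2, rfl⟩⟩
      invFun := fun x => ⟨(x.2.1.1, x.2.2.1), by
        rw [x.2.1.2, x.2.2.2]; exact mem_antidiagonal.1 x.1.2⟩
      left_inv := fun _ => rfl
      right_inv := by
        rintro ⟨⟨⟨a, b⟩, h⟩, ⟨i, hi⟩, ⟨j, hj⟩⟩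
        simp only at hi hj
        subst hi hj
        rfl }
  rw [Nat.card_congr F, Nat.card_sigma]
  simp only [Nat.card_prod]
  push_cast
  exact Finset.sum_coe_sort (antidiagonal n) fun d =>
    (Nat.card {i // e i = d.1} : ℤ) * (Nat.card {i // f i = d.2} : ℤ)

theorem expSeries_mul {ι : Type*} (e : ι → ℕ) (k : ℕ) (hk : k ≠ 0) :
    expSeries (fun i => k * e i) = expand k hk (expSeries e) := by
  ext n
  rw [coeff_expand]
  simp only [expSeries, coeff_mk]
  split_ifs with h
  · obtain ⟨m, rfl⟩ := h
    rw [Nat.mul_div_cancel_left _ (Nat.pos_of_ne_zero hk)]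
    exact congrArg _ (Nat.card_congr (Equiv.subtypeEquivRight fun i =>
      ⟨Nat.eq_of_mul_eq_mul_left (Nat.pos_of_ne_zero hk), fun h => by rw [h]⟩))
  · have : IsEmpty {i // k * e i = n} := ⟨fun i => h ⟨_, i.2.symm⟩⟩
    simp

theorem expSeries_add_one {ι : Type*} (e : ι → ℕ) :
    expSeries (fun i => e i + 1) = X * expSeries e := by
  ext n
  cases n with
  | zero => simp [expSeries]
  | succ n =>
    rw [coeff_succ_X_mul]
    simp [expSeries]

theorem hasSum_expSeries {ι : Type*} (e : ι → ℕ) [∀ n, Finite {i // e i = n}] :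
    HasSum (fun i => (X : ℤ⟦X⟧) ^ e i) (expSeries e) := by
  rw [hasSum_iff_hasSum_coeff]
  intro d
  have hfin : {i | e i = d}.Finite := Set.finite_coe_iff.1 (inferInstanceAs (Finite {i // e i = d}))
  have h := hasSum_sum_of_ne_finset_zero (f := fun i => coeff d ((X : ℤ⟦X⟧) ^ e i))
    (L := SummationFilter.unconditional ι)
    (s := hfin.toFinset) (by
      intro i hi
      rw [coeff_X_pow, if_neg]
      rintro rfl
      simp at hi)
  have hc : coeff d (expSeries e) =
      ∑ i ∈ hfin.toFinset, coeff d ((X : ℤ⟦X⟧) ^ e i) := by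
    rw [Finset.sum_congr rfl (g := fun _ => (1 : ℤ))]
    · simp only [expSeries, coeff_mk]
      rw [Finset.sum_const, nsmul_one, ← Nat.card_eq_card_finite_toFinset hfin]
      rfl
    · intro i hi
      rw [coeff_X_pow, if_pos]
      simpa [eq_comm] using hi
  rwa [hc]

/-! ### The theta functions `ψ` and `φ`. -/

/-- The triangular numbers. -/
def triangle (n : ℕ) : ℕ := n * (n + 1) / 2

theorem two_mul_triangle (n : ℕ) : 2 * triangle n = n * (n + 1) :=
  Nat.mul_div_cancel' (Nat.even_mul_succ_self n).two_dvd

theorem le_triangle (n : ℕ) : n ≤ triangle n := by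
  have := two_mul_triangle n
  rcases Nat.eq_zero_or_pos n with rfl | h
  · simp
  · nlinarith

instance finite_triangle_fiber (n : ℕ) : Finite {a // triangle a = n} :=
  Set.Finite.to_subtype ((Set.finite_Iic n).subset fun a (ha : triangle a = n) =>
    ha ▸ le_triangle a)

instance finite_natAbs_sq_fiber (n : ℕ) : Finite {a : ℤ // a.natAbs ^ 2 = n} :=
  Set.Finite.to_subtype ((Set.finite_Icc (-n : ℤ) n).subset fun a (ha : a.natAbs ^ 2 = n) => by
    have : a.natAbs ≤ n := by nlinarith [Nat.le_self_pow two_ne_zero a.natAbs]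
    constructor <;> omega)

theorem finite_mul_add_fiber {ι : Type*} (e : ι → ℕ) [∀ n, Finite {i // e i = n}]
    (k l : ℕ) (hk : k ≠ 0) (n : ℕ) : Finite {i // k * e i + l = n} :=
  Finite.of_injective (β := {i // e i = (n - l) / k}) (fun i => ⟨i.1, 
    (Nat.div_eq_of_eq_mul_right (Nat.pos_of_ne_zero hk) (Nat.sub_eq_of_eq_add i.2.symm)).symm⟩)
    fun _ _ h => Subtype.ext (congrArg (fun x => x.1) h)

instance finite_sumElim_fiber {ι κ : Type*} (e : ι → ℕ) (f : κ → ℕ) [∀ n, Finite {i // e i = n}]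
    [∀ n, Finite {i // f i = n}] (n : ℕ) : Finite {i // Sum.elim e f i = n} :=
  have _ : Finite {a // Sum.elim e f (Sum.inl a) = n} := inferInstanceAs (Finite {i // e i = n})
  have _ : Finite {b // Sum.elim e f (Sum.inr b) = n} := inferInstanceAs (Finite {i // f i = n})
  Finite.of_equiv _ (Equiv.subtypeSum (p := fun i => Sum.elim e f i = n)).symm

/-- Ramanujan's theta function `ψ`, the generating function of the triangular numbers. -/
noncomputable def psi : ℤ⟦X⟧ := expSeries triangle

/-- Ramanujan's theta function `φ`, the generating function of the squares of integers. -/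
noncomputable def phi : ℤ⟦X⟧ := expSeries fun a : ℤ => a.natAbs ^ 2

/-- Gauss's product formula for `ψ`. -/
theorem psi_mul_eulerProd : psi * eulerProd = expand 2 two_ne_zero eulerProd ^ 2 := by
  have hS : Filter.Tendsto (fun n => ∑ m ∈ range n, ((X : ℤ⟦X⟧) ^ (m * (2 * m + 1)) +
      X ^ ((m + 1) * (2 * m + 1)))) Filter.atTop (nhds psi) := by
    have := (hasSum_expSeries triangle).tendsto_sum_nat.comp
      (Filter.tendsto_id.const_mul_atTop' (two_pos : 0 < 2))
    refine this.congr fun n => ?_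
    simp only [Function.comp, id]
    induction n with
    | zero => simp
    | succ n ih =>
      rw [sum_range_succ, ← ih, show 2 * (n + 1) = 2 * n + 1 + 1 from rfl, sum_range_succ,
        sum_range_succ, add_assoc]
      have h1 : triangle (2 * n) = n * (2 * n + 1) := by
        have := two_mul_triangle (2 * n); nlinarith
      have h2 : triangle (2 * n + 1) = (n + 1) * (2 * n + 1) := by
        have := two_mul_triangle (2 * n + 1); nlinarith
      rw [h1, h2]
  have hN : Filter.Tendsto (fun n => ∏ k ∈ range n, ((1 : ℤ⟦X⟧) - X ^ (2 * k + 2)))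
      Filter.atTop (nhds (expand 2 two_ne_zero eulerProd)) :=
    (hasProd_expand_eulerProd 2 two_ne_zero).tendsto_prod_nat
  have hE : Filter.Tendsto (fun n => (∏ k ∈ range n, ((1 : ℤ⟦X⟧) - X ^ (2 * k + 2))) *
      ∏ k ∈ range n, ((1 : ℤ⟦X⟧) - X ^ (2 * k + 1))) Filter.atTop (nhds eulerProd) := by
    have := hasProd_eulerProd.tendsto_prod_nat.comp
      (Filter.tendsto_id.const_mul_atTop' (two_pos : 0 < 2))
    refine this.congr fun n => ?_
    simp only [Function.comp, id]
    induction n with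
    | zero => simp
    | succ n ih =>
      rw [prod_range_succ _ n, prod_range_succ _ n, show 2 * (n + 1) = 2 * n + 1 + 1 from rfl,
        prod_range_succ, prod_range_succ, ih]
      ring
  -- In Shanks's sum the terms after the first have order exceeding `n`, so they vanish in the
  -- limit; the first term tends to `f₂`.
  have hR : Filter.Tendsto (fun n => ∑ s ∈ range n,
      (∏ k ∈ range (s + 1), ((1 : ℤ⟦X⟧) - X ^ (2 * k + 1))) *
        (∏ k ∈ Ico (s + 1) (n + 1), (1 - X ^ (2 * k + 2))) *
          X ^ ((s + 1) * (2 * (n + 1) + 1))) Filter.atTop (nhds 0) := by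
    rw [tendsto_iff_coeff_tendsto]
    refine fun d => tendsto_atTop_of_eventually_const (i₀ := d) fun n hn => ?_
    rw [map_sum, map_zero]
    refine sum_eq_zero fun s _ => ?_
    rw [coeff_mul_X_pow', if_neg]
    nlinarith
  have hN' := hN.comp (Filter.tendsto_add_atTop_nat 1)
  have h1 := (hE.mul hS).comp (Filter.tendsto_add_atTop_nat 1)
  have h2 := hN'.mul (hR.add hN')
  rw [mul_comm psi, sq, ← zero_add (expand 2 _ _ * _), ← mul_zero (expand 2 two_ne_zero eulerProd),
    ← mul_add]
  refine tendsto_nhds_unique h1 (h2.congr fun n => ?_)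
  simp only [Function.comp]
  rw [mul_assoc, prod_odd_mul_sum_pow_triangle, sum_range_succ']
  simp

/-- The `2`-dissection of the pairs of triangular numbers: `(m, n)` corresponds to the pair
of naturals whose half-sum and half-difference it is, or of integers obtained by reflection. -/
def trianglePairEquiv : ℕ × ℕ ≃ ℤ × ℕ where
  toFun p := if (p.1 + p.2) % 2 = 0 then (((p.1 : ℤ) - p.2) / 2, (p.1 + p.2) / 2)
    else if p.1 < p.2 then (-(((p.1 : ℤ) + p.2 + 1) / 2), (p.2 - p.1 - 1) / 2)
    else (((p.1 : ℤ) + p.2 + 1) / 2, (p.1 - p.2 - 1) / 2)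
  invFun p := if p.1.natAbs ≤ p.2 then ((p.2 + p.1).toNat, (p.2 - p.1).toNat)
    else if p.1 < 0 then ((-p.1 - p.2 - 1).toNat, (-p.1 + p.2).toNat)
    else ((p.1 + p.2).toNat, (p.1 - p.2 - 1).toNat)
  left_inv := by
    rintro ⟨a, b⟩
    simp only
    split_ifs <;> simp only [Prod.mk.injEq] <;> simp_all only <;> omega
  right_inv := by
    rintro ⟨m, n⟩
    simp only
    split_ifs <;> simp only [Prod.mk.injEq] <;> simp_all only <;> omega

/-- With `T(x) = x(x+1)/2` on the integers, `T(n+m) + T(n-m) = m² + 2T(n)`. The reflection `T(-x-1)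
= T(x)` replaces a negative argument by a natural one, giving the three cases. -/
theorem triangle_trianglePairEquiv_symm (p : ℤ × ℕ) :
    triangle (trianglePairEquiv.symm p).1 + triangle (trianglePairEquiv.symm p).2 =
      p.1.natAbs ^ 2 + 2 * triangle p.2 := by
  obtain ⟨m, n⟩ := p
  have key : ∀ a b : ℕ, ((a : ℤ) = n + m ∧ (b : ℤ) = n - m) ∨
      ((a : ℤ) = -m - n - 1 ∧ (b : ℤ) = -m + n) ∨ ((a : ℤ) = m + n ∧ (b : ℤ) = m - n - 1) →
      triangle a + triangle b = m.natAbs ^ 2 + 2 * triangle n := by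
    intro a b h
    have ha := two_mul_triangle a
    have hb := two_mul_triangle b
    have hn := two_mul_triangle n
    zify at ha hb hn ⊢
    rw [sq_abs]
    rcases h with ⟨h1, h2⟩ | ⟨h1, h2⟩ | ⟨h1, h2⟩ <;> rw [h1] at ha <;> rw [h2] at hb <;>
      linarith
  apply key
  simp only [trianglePairEquiv, Equiv.coe_fn_symm_mk]
  split_ifs <;> simp only <;> omega

theorem psi_sq : psi ^ 2 = phi * expand 2 two_ne_zero psi := by
  have (n : ℕ) : Finite {a // 2 * triangle a = n} := finite_mul_add_fiber triangle 2 0 two_ne_zero n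
  rw [sq, psi, phi, ← expSeries_mul, ← expSeries_prod, ← expSeries_prod,
    ← expSeries_comp_equiv _ trianglePairEquiv.symm]
  exact congrArg expSeries (funext triangle_trianglePairEquiv_symm)

/-- The integers, split into even ones, positive odd ones and negative odd ones. -/
def intParityEquiv : ℤ ⊕ (ℕ ⊕ ℕ) ≃ ℤ where
  toFun := Sum.elim (fun a => 2 * a) (Sum.elim (fun n => 2 * n + 1) (fun n => -(2 * n + 1)))
  invFun a := if a % 2 = 0 then Sum.inl (a / 2)
    else if 0 < a then Sum.inr (Sum.inl (a / 2).toNat) else Sum.inr (Sum.inr (-a / 2).toNat)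
  left_inv := by
    rintro (a | n | n)
    · simp
    · change (if (2 * (n : ℤ) + 1) % 2 = 0 then _ else _) = _
      rw [if_neg (by omega)]
      change (if 0 < 2 * (n : ℤ) + 1 then _ else _) = _
      rw [if_pos (by omega)]
      refine congrArg (fun k => Sum.inr (Sum.inl k)) ?_
      change ((2 * (n : ℤ) + 1) / 2).toNat = n
      omega
    · change (if (-(2 * (n : ℤ) + 1)) % 2 = 0 then _ else _) = _
      rw [if_neg (by omega)]
      change (if 0 < -(2 * (n : ℤ) + 1) then _ else _) = _
      rw [if_neg (by omega)]
      refine congrArg (fun k => Sum.inr (Sum.inr k)) ?_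
      change (-(-(2 * (n : ℤ) + 1)) / 2).toNat = n
      omega
  right_inv := by
    intro a
    simp only
    split_ifs <;> simp only [Sum.elim_inr, Sum.elim_inl] <;> omega

/-- Even integers contribute `4a²`; each odd square is `8T + 1` with `T` triangular and arises from
both signs, hence the factor 2. -/
theorem phi_eq : phi = expand 4 four_ne_zero phi + 2 * X * expand 8 (by norm_num) psi := by
  have h4 (n : ℕ) : Finite {a : ℤ // 4 * a.natAbs ^ 2 = n} :=
    finite_mul_add_fiber (fun a : ℤ => a.natAbs ^ 2) 4 0 four_ne_zero n
  have h8 (n : ℕ) : Finite {a // 8 * triangle a + 1 = n} := finite_mul_add_fiber triangle 8 1 (by norm_num) n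
  have : phi = expSeries (Sum.elim (fun a : ℤ => 4 * a.natAbs ^ 2)
      (Sum.elim (fun a => 8 * triangle a + 1) (fun a => 8 * triangle a + 1))) := by
    rw [phi, ← expSeries_comp_equiv _ intParityEquiv]
    refine congrArg expSeries (funext ?_)
    have hodd : ∀ n : ℕ, (2 * n + 1) ^ 2 = 8 * triangle n + 1 := fun n => by
      have := two_mul_triangle n
      nlinarith
    rintro (a | n | n)
    · simp [intParityEquiv, Int.natAbs_mul, mul_pow]
    · simp only [intParityEquiv, Equiv.coe_fn_mk, Sum.elim_inr, Sum.elim_inl]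
      rw [← hodd]; congr 1
    · simp only [intParityEquiv, Equiv.coe_fn_mk, Sum.elim_inr]
      rw [← hodd, Int.natAbs_neg]; congr 1
  conv_lhs => rw [this, expSeries_sum, expSeries_sum, expSeries_add_one (fun a => 8 * triangle a),
    expSeries_mul (fun a : ℤ => a.natAbs ^ 2) 4 four_ne_zero, expSeries_mul triangle 8 (by norm_num)]
  rw [← phi, ← psi]
  ring

/-! ### Even and odd parts of a series. -/

/-- The substitution `X ↦ X ^ 2`. -/
noncomputable def dilate : ℤ⟦X⟧ →+* ℤ⟦X⟧ := (expand 2 two_ne_zero : ℤ⟦X⟧ →ₐ[ℤ] ℤ⟦X⟧)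

theorem dilate_apply (f : ℤ⟦X⟧) : dilate f = expand 2 two_ne_zero f := rfl

theorem dilate_dilate (f : ℤ⟦X⟧) : dilate (dilate f) = expand 4 four_ne_zero f :=
  (expand_mul 2 two_ne_zero 2 two_ne_zero f).symm

theorem dilate_dilate_dilate (f : ℤ⟦X⟧) :
    dilate (dilate (dilate f)) = expand 8 (by norm_num) f := by
  rw [dilate_dilate]
  exact (expand_mul 4 four_ne_zero 2 two_ne_zero f).symm

@[simp] theorem dilate_X : dilate X = X ^ 2 := expand_X 2 two_ne_zero

theorem coeff_dilate_two_mul (f : ℤ⟦X⟧) (n : ℕ) : coeff (2 * n) (dilate f) = coeff n f :=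
  coeff_expand_mul 2 two_ne_zero f n

theorem coeff_dilate_two_mul_add_one (f : ℤ⟦X⟧) (n : ℕ) : coeff (2 * n + 1) (dilate f) = 0 :=
  coeff_expand_of_not_dvd 2 two_ne_zero f (by omega)

theorem coeff_two_mul_of_eq {f a b : ℤ⟦X⟧} (h : f = dilate a + X * dilate b) (n : ℕ) :
    coeff (2 * n) f = coeff n a := by
  rw [h, map_add, coeff_dilate_two_mul]
  cases n with
  | zero => simp
  | succ n =>
    rw [show 2 * (n + 1) = 2 * n + 1 + 1 from rfl, coeff_succ_X_mul,
      coeff_dilate_two_mul_add_one, add_zero]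

theorem coeff_two_mul_add_one_of_eq {f a b : ℤ⟦X⟧} (h : f = dilate a + X * dilate b) (n : ℕ) :
    coeff (2 * n + 1) f = coeff n b := by
  rw [h, map_add, coeff_dilate_two_mul_add_one, coeff_succ_X_mul, coeff_dilate_two_mul, zero_add]

/-- Odd coefficients vanish, the coefficient at `2m` is minus that at `m`, and the constant term is
its own negative; descent on the index does the rest. -/
theorem eq_zero_of_eq_neg_dilate {f : ℤ⟦X⟧} (h : f = -dilate f) : f = 0 := by
  ext n
  induction n using Nat.strong_induction_on with
  | _ n ih =>
    have hn : coeff n f = -coeff n (dilate f) := by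
      conv_lhs => rw [h]
      rw [map_neg]
    obtain ⟨m, rfl | rfl⟩ := Nat.even_or_odd' n
    · rw [coeff_dilate_two_mul] at hn
      rcases Nat.eq_zero_or_pos m with rfl | hm
      · simp only [mul_zero, map_zero] at hn ⊢
        omega
      · rw [hn, ih m (by omega)]
        simp
    · rw [hn, coeff_dilate_two_mul_add_one]
      simp

/-! ### The overpartition series and theta identities. -/

theorem isUnit_eulerProd : IsUnit eulerProd := by
  have h := hasProd_eulerProd.map (constantCoeff (R := ℤ)) (continuous_constantCoeff ℤ)
  have h1 : HasProd (fun _ : ℕ => (1 : ℤ)) (constantCoeff eulerProd) :=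
    h.congr_fun fun i => by simp
  rw [isUnit_iff_constantCoeff, h1.unique hasProd_one]
  exact isUnit_one

/-- The generating function of all overpartitions, `f₂ / f₁ ^ 2`. -/
noncomputable def overSeries : ℤ⟦X⟧ :=
  dilate eulerProd * (isUnit_eulerProd.unit⁻¹ : ℤ⟦X⟧ˣ) ^ 2

theorem overSeries_mul_sq : overSeries * eulerProd ^ 2 = dilate eulerProd := by
  rw [overSeries, mul_assoc, ← mul_pow, IsUnit.val_inv_mul, one_pow, mul_one]

theorem regularSeries_eight :
    regularSeries 8 = overSeries * dilate (dilate (dilate eulerProd)) := by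
  have h := regularSeries_mul_sq 8 (by norm_num)
  rw [← dilate_apply, ← dilate_dilate_dilate] at h
  refine (isUnit_eulerProd.pow 2).mul_right_cancel ?_
  linear_combination h - dilate (dilate (dilate eulerProd)) * overSeries_mul_sq

theorem psi_mul_eulerProd' : psi * eulerProd = dilate eulerProd ^ 2 := psi_mul_eulerProd

theorem psi_sq' : psi ^ 2 = phi * dilate psi := psi_sq

theorem phi_eq' : phi = dilate (dilate phi) + 2 * X * dilate (dilate (dilate psi)) := by
  rw [dilate_dilate, dilate_dilate_dilate]
  exact phi_eq

/-- If `d` is the difference of the two sides, squaring the dissection of `φ` and using `ψ² = φ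
ψ(q²)` at `q⁴` gives `d(q) + d(q²) = 0`. -/
theorem phi_sq : phi ^ 2 = dilate (phi ^ 2) + 4 * X * dilate (dilate psi ^ 2) := by
  rw [← sub_eq_zero]
  refine eq_zero_of_eq_neg_dilate ?_
  have h1 := congrArg dilate (congrArg dilate psi_sq')
  have h2 := phi_eq'
  simp only [map_sub, map_add, map_mul, map_pow, map_ofNat, dilate_X] at h1 ⊢
  linear_combination (phi + (dilate (dilate phi) + 2 * X * dilate (dilate (dilate psi)))) * h2
    - 4 * X * h1

theorem overSeries_eq : overSeries = phi * dilate overSeries ^ 2 := by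
  have hu : IsUnit (eulerProd ^ 2 * dilate eulerProd ^ 4) :=
    (isUnit_eulerProd.pow 2).mul ((isUnit_eulerProd.map dilate).pow 4)
  have h1 := overSeries_mul_sq
  have h2 := congrArg dilate h1
  have h3 := psi_mul_eulerProd'
  have h4 := congrArg dilate h3
  have h5 := psi_sq'
  simp only [map_mul, map_pow] at h2 h4
  refine hu.mul_right_cancel ?_
  set E := eulerProd
  set E2 := dilate E
  set E4 := dilate E2
  -- The product formula `φ = f₂⁵ / (f₁² f₄²)`, obtained from `ψ = f₂² / f₁` and `ψ² = φ ψ(q²)`.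
  have h6 : phi * E ^ 2 * E4 ^ 2 = E2 ^ 5 := by
    linear_combination -phi * E ^ 2 * h4 - E ^ 2 * E2 * h5 + (psi * E + E2 ^ 2) * E2 * h3
  linear_combination E2 ^ 4 * h1 - h6 - phi * E ^ 2 * (dilate overSeries * E2 ^ 2 + E4) * h2

/-- Over `ZMod 2`, Frobenius fixes the coefficients and substitutes `X ^ 2` for `X`. -/
theorem sq_eq_dilate_add (f : ℤ⟦X⟧) : ∃ r, f ^ 2 = dilate f + 2 * r := by
  have h : PowerSeries.map (Int.castRingHom (ZMod 2)) (f ^ 2 - dilate f) = 0 := by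
    rw [map_sub, map_pow, dilate_apply, map_expand, sub_eq_zero]
    have := MvPowerSeries.map_frobenius_expand 2 two_ne_zero
      (f := (PowerSeries.map (Int.castRingHom (ZMod 2)) f))
    rw [ZMod.frobenius_zmod] at this
    exact this.symm.trans (by simp [expand])
  refine ⟨PowerSeries.mk fun n => coeff n (f ^ 2 - dilate f) / 2, ?_⟩
  rw [← sub_eq_iff_eq_add']
  ext n
  have hn := congrArg (coeff n) h
  rw [coeff_map, map_zero, eq_intCast, ZMod.intCast_zmod_eq_zero_iff_dvd] at hn
  rw [show (2 : ℤ⟦X⟧) = C 2 from (map_ofNat C 2).symm, coeff_C_mul, coeff_mk]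
  exact (Int.mul_ediv_cancel' hn).symm

/-! ### Explicit dissections along progressions. -/

/-- The square of `φ`. -/
noncomputable def phiSq : ℤ⟦X⟧ := phi ^ 2

/-- The series `ψ(X ^ 2) ^ 2`. -/
noncomputable def psiTwoSq : ℤ⟦X⟧ := dilate psi ^ 2

theorem phiSq_eq : phiSq = dilate phiSq + 4 * X * dilate psiTwoSq := phi_sq

theorem psiTwoSq_sq : psiTwoSq ^ 2 = dilate phiSq * dilate psiTwoSq := by
  have h := congrArg dilate psi_sq'
  simp only [map_mul, map_pow] at h
  simp only [psiTwoSq, phiSq, map_pow]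
  linear_combination (dilate psi ^ 2 + dilate phi * dilate (dilate psi)) * h

theorem overSeries_sq : overSeries ^ 2 = phiSq * dilate overSeries ^ 4 := by
  rw [phiSq]
  linear_combination (overSeries + phi * dilate overSeries ^ 2) * overSeries_eq

theorem dilate_eulerProd_mul_psi : dilate eulerProd * dilate psi = dilate (dilate eulerProd) ^ 2 := by
  rw [mul_comm, ← map_mul, psi_mul_eulerProd', map_pow]

theorem dilate_eulerProd_sq_mul_psiTwoSq :
    dilate eulerProd ^ 2 * psiTwoSq = dilate (dilate eulerProd ^ 4) := by
  rw [psiTwoSq, ← mul_pow, dilate_eulerProd_mul_psi, map_pow]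
  ring

/-- The generating function of `overlineRStar 8 (2 * n + 1)`. -/
noncomputable def series21 : ℤ⟦X⟧ :=
  dilate (dilate eulerProd) * dilate (dilate overSeries) ^ 8 *
    (2 * dilate (phi ^ 6) * dilate (dilate psi) +
      8 * X * dilate (phi ^ 4) * dilate (dilate psi ^ 3))

theorem coeff_series21 (n : ℕ) :
    (overlineRStar 8 (2 * n + 1) : ℤ) = coeff n series21 := by
  rw [← coeff_two_mul_add_one_of_eq (f := regularSeries 8) (b := series21)
    (a := dilate (dilate eulerProd) * dilate (dilate overSeries) ^ 8 * dilate phi ^ 5 *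
      (dilate phi ^ 2 + 4 * X * dilate (dilate psi) ^ 2)) ?_ n]
  · rw [regularSeries, coeff_mk]
  have h1 := overSeries_eq
  have h2 := congrArg dilate h1
  have h3 := congrArg dilate h2
  have h4 := phi_eq'
  have h5 := congrArg dilate phi_sq
  rw [regularSeries_eight, series21]
  simp only [map_add, map_mul, map_pow, map_ofNat, dilate_X] at h2 h3 h4 h5 ⊢
  -- The recursion for `W`, iterated three times; afterwards only `φ(q)` and `φ(q²)²` need
  -- dissecting, as the other factors are series in `q⁴`.
  have hW : overSeries = phi * dilate phi ^ 2 * dilate (dilate phi) ^ 4 *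
      dilate (dilate (dilate overSeries)) ^ 8 := by
    generalize dilate (dilate (dilate overSeries)) = w at h3 ⊢
    generalize dilate (dilate overSeries) = w at h2 h3
    generalize dilate overSeries = w at h1 h2
    rw [h1, h2, h3]
    ring
  linear_combination dilate (dilate (dilate eulerProd)) * hW +
    dilate (dilate (dilate eulerProd)) * dilate (dilate (dilate overSeries)) ^ 8 *
      dilate (dilate phi) ^ 4 * (dilate phi ^ 2 * h4 +
        (dilate (dilate phi) + 2 * X * dilate (dilate (dilate psi))) * h5)

/-- The generating function of `overlineRStar 8 (8 * n + 1)`. -/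
noncomputable def series81 : ℤ⟦X⟧ :=
  2 * dilate eulerProd ^ 2 * overSeries ^ 8 * (phiSq ^ 3 + 48 * X * phiSq * psiTwoSq ^ 2)

/-- The generating function of `overlineRStar 8 (8 * n + 3)`. -/
noncomputable def series83 : ℤ⟦X⟧ :=
  8 * dilate eulerProd ^ 2 * psi ^ 2 * overSeries ^ 8 * (phiSq ^ 2 + 16 * X * psiTwoSq ^ 2)

/-- The generating function of `overlineRStar 8 (8 * n + 5)`. -/
noncomputable def series85 : ℤ⟦X⟧ :=
  8 * dilate (dilate eulerProd ^ 4) * overSeries ^ 8 * (3 * phiSq ^ 2 + 16 * X * psiTwoSq ^ 2)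

/-- The generating function of `overlineRStar 8 (8 * n + 7)`. -/
noncomputable def series87 : ℤ⟦X⟧ :=
  64 * dilate eulerProd ^ 2 * psi ^ 2 * overSeries ^ 8 * phiSq * psiTwoSq

/-- The generating function of `overlineRStar 8 (4 * n + 1)`. -/
noncomputable def series41 : ℤ⟦X⟧ :=
  2 * dilate eulerProd * dilate overSeries ^ 8 * phiSq ^ 3 * dilate psi

/-- The generating function of `overlineRStar 8 (4 * n + 3)`. -/
noncomputable def series43 : ℤ⟦X⟧ :=
  8 * dilate eulerProd * dilate overSeries ^ 8 * phiSq ^ 2 * dilate psi ^ 3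

theorem series21_eq : series21 = dilate series41 + X * dilate series43 := by
  simp only [series21, series41, series43, phiSq, map_mul, map_pow, map_ofNat]
  ring

/-- Since `f₂ ψ(q²) = f₄²`, the prefactor is a series in `q²`, and parity is decided by expanding
`(A(q²) + 4q B(q²))³`. -/
theorem series41_eq : series41 = dilate series81 + X * dilate series85 := by
  have hp := phiSq_eq
  have h3 := dilate_eulerProd_mul_psi
  rw [series41, series81, series85, ← dilate_eulerProd_sq_mul_psiTwoSq]
  simp only [map_add, map_mul, map_pow, map_ofNat, dilate_X]
  generalize dilate phiSq = A at hp ⊢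
  generalize dilate psiTwoSq = B at hp ⊢
  rw [hp]
  linear_combination 2 * dilate overSeries ^ 8 * (A + 4 * X * B) ^ 3 * h3

theorem series43_eq : series43 = dilate series83 + X * dilate series87 := by
  have hp := phiSq_eq
  have h3 := dilate_eulerProd_mul_psi
  rw [series43, series83, series87]
  simp only [map_add, map_mul, map_pow, map_ofNat, dilate_X]
  generalize dilate phiSq = A at hp ⊢
  generalize dilate psiTwoSq = B at hp ⊢
  rw [hp]
  linear_combination 8 * dilate overSeries ^ 8 * dilate psi ^ 2 * (A + 4 * X * B) ^ 2 * h3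

/-- The generating function of `overlineRStar 8 (16 * n + 5)`. -/
noncomputable def series165 : ℤ⟦X⟧ :=
  8 * dilate eulerProd ^ 4 * overSeries ^ 16 *
    (3 * phiSq ^ 6 + 976 * X * phiSq ^ 4 * psiTwoSq ^ 2 +
      15616 * X ^ 2 * phiSq ^ 2 * psiTwoSq ^ 4 + 12288 * X ^ 3 * psiTwoSq ^ 6)

/-- The generating function of `overlineRStar 8 (16 * n + 13)`. -/
noncomputable def series1613 : ℤ⟦X⟧ :=
  64 * dilate eulerProd ^ 4 * overSeries ^ 16 * psiTwoSq *
    (11 * phiSq ^ 5 + 672 * X * phiSq ^ 3 * psiTwoSq ^ 2 + 2816 * X ^ 2 * phiSq * psiTwoSq ^ 4)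

/-- The factor `W⁸ = A⁴ W(q²)¹⁶` leaves a polynomial in `X`, `A` and `B²`, which the two basic
identities rewrite in terms of `X`, `A(q²)` and `B(q²)`. -/
theorem series85_eq : series85 = dilate series165 + X * dilate series1613 := by
  have h : overSeries ^ 8 = phiSq ^ 4 * dilate overSeries ^ 16 := by
    rw [show 8 = 2 * 4 from rfl, pow_mul, overSeries_sq]
    ring
  have hp := phiSq_eq
  have h2 := psiTwoSq_sq
  rw [series85, series165, series1613, h]
  simp only [map_add, map_mul, map_pow, map_ofNat, dilate_X]
  generalize dilate phiSq = A at hp h2 ⊢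
  generalize dilate psiTwoSq = B at hp h2 ⊢
  rw [hp, h2]
  ring

/-- The even part of the dissection of `series165`. -/
noncomputable def series325 : ℤ⟦X⟧ :=
  8 * eulerProd ^ 4 * overSeries ^ 32 *
    (3 * phiSq ^ 14 + 66832 * X * phiSq ^ 12 * psiTwoSq ^ 2 +
      26147584 * X ^ 2 * phiSq ^ 10 * psiTwoSq ^ 4 +
      1712001024 * X ^ 3 * phiSq ^ 8 * psiTwoSq ^ 6 +
      27392016384 * X ^ 4 * phiSq ^ 6 * psiTwoSq ^ 8 +
      107100504064 * X ^ 5 * phiSq ^ 4 * psiTwoSq ^ 10 +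
      70078431232 * X ^ 6 * phiSq ^ 2 * psiTwoSq ^ 12 + 805306368 * X ^ 7 * psiTwoSq ^ 14)

/-- The generating function of `overlineRStar 8 (32 * n + 21)`. -/
noncomputable def series3221 : ℤ⟦X⟧ :=
  8 * eulerProd ^ 4 * overSeries ^ 32 * phiSq * psiTwoSq *
    (1144 * phiSq ^ 12 + 1737472 * X * phiSq ^ 10 * psiTwoSq ^ 2 +
      255264768 * X ^ 2 * phiSq ^ 8 * psiTwoSq ^ 4 +
      8112439296 * X ^ 3 * phiSq ^ 6 * psiTwoSq ^ 6 +
      65347780608 * X ^ 4 * phiSq ^ 4 * psiTwoSq ^ 8 +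
      113866964992 * X ^ 5 * phiSq ^ 2 * psiTwoSq ^ 10 +
      19193135104 * X ^ 6 * psiTwoSq ^ 12)

theorem series165_eq : series165 = dilate series325 + X * dilate series3221 := by
  have h : overSeries ^ 16 = phiSq ^ 8 * dilate overSeries ^ 32 := by
    rw [show 16 = 2 * 8 from rfl, pow_mul, overSeries_sq]
    ring
  have hp := phiSq_eq
  have h2 := psiTwoSq_sq
  have h4 : psiTwoSq ^ 4 = (psiTwoSq ^ 2) ^ 2 := pow_mul psiTwoSq 2 2
  have h6 : psiTwoSq ^ 6 = (psiTwoSq ^ 2) ^ 3 := pow_mul psiTwoSq 2 3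
  rw [series165, series325, series3221, h]
  simp only [map_add, map_mul, map_pow, map_ofNat, dilate_X]
  generalize dilate phiSq = A at hp h2 ⊢
  generalize dilate psiTwoSq = B at hp h2 ⊢
  rw [h4, h6, h2, hp]
  ring

/-! ### Congruences modulo powers of 2. -/

/-- Only the quotient of the power series ring by `m` is used; stating the hypothesis for any ring
with `m = 0` makes congruences into equations. -/
theorem coeff_modEq (m : ℕ) {f g : ℤ⟦X⟧}
    (h : ∀ (Q : Type) [CommRing Q] (π : ℤ⟦X⟧ →+* Q), (m : Q) = 0 → π f = π g) (n : ℕ) :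
    coeff n f ≡ coeff n g [ZMOD m] := by
  have h1 := h _ (Ideal.Quotient.mk (Ideal.span {(m : ℤ⟦X⟧)})) (by
    rw [← map_natCast (Ideal.Quotient.mk (Ideal.span {(m : ℤ⟦X⟧)})), Ideal.Quotient.eq_zero_iff_mem]
    exact Ideal.mem_span_singleton_self _)
  rw [Ideal.Quotient.eq, Ideal.mem_span_singleton'] at h1
  obtain ⟨a, ha⟩ := h1
  refine (Int.modEq_of_dvd ⟨coeff n a, ?_⟩).symm
  rw [← map_sub, ← ha, show (m : ℤ⟦X⟧) = C (m : ℤ) from (map_natCast C m).symm, mul_comm,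
    coeff_C_mul]

theorem dvd_coeff_two_mul_add_one (m : ℕ) {f g : ℤ⟦X⟧}
    (h : ∀ (Q : Type) [CommRing Q] (π : ℤ⟦X⟧ →+* Q), (m : Q) = 0 → π f = π (dilate g)) (n : ℕ) :
    (m : ℤ) ∣ coeff (2 * n + 1) f := by
  have h1 := coeff_modEq m h (2 * n + 1)
  rw [coeff_dilate_two_mul_add_one] at h1
  exact Int.modEq_zero_iff_dvd.1 h1

theorem coeff_ofNat_mul (k : ℕ) [k.AtLeastTwo] (f : ℤ⟦X⟧) (n : ℕ) :
    coeff n (ofNat(k) * f) = ofNat(k) * coeff n f := by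
  rw [← map_ofNat (C (R := ℤ)) k, coeff_C_mul]

theorem exists_pow_two_pow_eq {R : Type*} [CommRing R] {x u : R} (h : x = 1 + 2 * u) (k : ℕ) :
    ∃ v, x ^ 2 ^ k = 1 + 2 ^ (k + 1) * v := by
  induction k with
  | zero => exact ⟨u, by rw [h]; ring⟩
  | succ k ih =>
    obtain ⟨v, hv⟩ := ih
    refine ⟨v + 2 ^ k * v ^ 2, ?_⟩
    rw [pow_succ, pow_mul, hv]
    ring

theorem pow_two_pow_eq_one {f u : ℤ⟦X⟧} (h : f = 1 + 2 * u) (k : ℕ) {Q : Type} [CommRing Q]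
    (π : ℤ⟦X⟧ →+* Q) (hQ : (2 : Q) ^ (k + 1) = 0) : π f ^ 2 ^ k = 1 := by
  obtain ⟨v, hv⟩ := exists_pow_two_pow_eq h k
  rw [← map_pow, hv, map_add, map_mul, map_pow, map_one, map_ofNat π 2, hQ, zero_mul, add_zero]

/-- `W f₁² = f₂` and `f₁² ≡ f₂ (mod 2)`, with `f₁²` invertible. -/
theorem exists_overSeries_eq : ∃ u, overSeries = 1 + 2 * u := by
  obtain ⟨r, hr⟩ := sq_eq_dilate_add eulerProd
  have hu := isUnit_eulerProd.pow 2
  refine ⟨-r * (hu.unit⁻¹ : ℤ⟦X⟧ˣ), hu.mul_right_cancel ?_⟩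
  have h1 : ((hu.unit⁻¹ : ℤ⟦X⟧ˣ) : ℤ⟦X⟧) * eulerProd ^ 2 = 1 := hu.val_inv_mul
  linear_combination overSeries_mul_sq - hr + 2 * r * h1

theorem isUnit_psi : IsUnit psi := by
  refine isUnit_of_mul_isUnit_left (y := eulerProd) ?_
  rw [psi_mul_eulerProd']
  exact (isUnit_eulerProd.map dilate).pow 2

/-- `φ ψ(q²) = ψ² ≡ ψ(q²) (mod 2)`, with `ψ(q²)` invertible. -/
theorem exists_phi_eq : ∃ u, phi = 1 + 2 * u := by
  obtain ⟨r, hr⟩ := sq_eq_dilate_add psi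
  have hu := isUnit_psi.map dilate
  refine ⟨r * (hu.unit⁻¹ : ℤ⟦X⟧ˣ), hu.mul_right_cancel ?_⟩
  have h1 : ((hu.unit⁻¹ : ℤ⟦X⟧ˣ) : ℤ⟦X⟧) * dilate psi = 1 := hu.val_inv_mul
  linear_combination hr - psi_sq' - 2 * r * h1

section Quotient

variable {Q : Type} [CommRing Q] (π : ℤ⟦X⟧ →+* Q)

theorem map_phiSq_of_four (h : (4 : Q) = 0) : π phiSq = 1 := by
  obtain ⟨u, hu⟩ := exists_phi_eq
  rw [phiSq, map_pow]
  exact pow_two_pow_eq_one hu 1 π (by linear_combination h)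

theorem map_phiSq_sq_of_eight (h : (8 : Q) = 0) : π phiSq ^ 2 = 1 := by
  obtain ⟨u, hu⟩ := exists_phi_eq
  rw [phiSq, map_pow, ← pow_mul]
  exact pow_two_pow_eq_one hu 2 π (by linear_combination h)

theorem map_phiSq_pow_four_of_sixteen (h : (16 : Q) = 0) : π phiSq ^ 4 = 1 := by
  obtain ⟨u, hu⟩ := exists_phi_eq
  rw [phiSq, map_pow, ← pow_mul]
  exact pow_two_pow_eq_one hu 3 π (by linear_combination h)

theorem map_overSeries_pow_four_of_eight (h : (8 : Q) = 0) : π overSeries ^ 4 = 1 := by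
  obtain ⟨u, hu⟩ := exists_overSeries_eq
  exact pow_two_pow_eq_one hu 2 π (by linear_combination h)

theorem map_overSeries_pow_eight_of_eight (h : (8 : Q) = 0) : π overSeries ^ 8 = 1 := by
  rw [pow_mul _ 4 2, map_overSeries_pow_four_of_eight π h, one_pow]

theorem map_overSeries_pow_sixteen_of_eight (h : (8 : Q) = 0) : π overSeries ^ 16 = 1 := by
  rw [pow_mul _ 4 4, map_overSeries_pow_four_of_eight π h, one_pow]

theorem map_overSeries_pow_sixty_of_eight (h : (8 : Q) = 0) : π overSeries ^ 60 = 1 := by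
  rw [pow_mul _ 4 15, map_overSeries_pow_four_of_eight π h, one_pow]

theorem map_eulerProd_sq_of_two (h : (2 : Q) = 0) : π eulerProd ^ 2 = π (dilate eulerProd) := by
  obtain ⟨r, hr⟩ := sq_eq_dilate_add eulerProd
  rw [← map_pow, hr, map_add, map_mul, map_ofNat, h, zero_mul, add_zero]

theorem map_psi_sq_of_two (h : (2 : Q) = 0) : π psi ^ 2 = π (dilate psi) := by
  obtain ⟨r, hr⟩ := sq_eq_dilate_add psi
  rw [← map_pow, hr, map_add, map_mul, map_ofNat, h, zero_mul, add_zero]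

/-- Squaring a congruence modulo 2 gives one modulo 4. -/
theorem map_eulerProd_pow_four_of_four (h : (4 : Q) = 0) :
    π eulerProd ^ 4 = π (dilate eulerProd) ^ 2 := by
  obtain ⟨r, hr⟩ := sq_eq_dilate_add eulerProd
  rw [show 4 = 2 * 2 from rfl, pow_mul, ← map_pow, hr, map_add, map_mul, map_ofNat]
  linear_combination (π (dilate eulerProd) * π r + π r ^ 2) * h

end Quotient

/-! ### Coefficients and the individual divisibilities. -/

theorem coeff_series41 (n : ℕ) : (overlineRStar 8 (4 * n + 1) : ℤ) = coeff n series41 := by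
  rw [← coeff_two_mul_of_eq series21_eq, ← coeff_series21]
  ring_nf

theorem coeff_series43 (n : ℕ) : (overlineRStar 8 (4 * n + 3) : ℤ) = coeff n series43 := by
  rw [← coeff_two_mul_add_one_of_eq series21_eq, ← coeff_series21]
  ring_nf

theorem coeff_series81 (n : ℕ) : (overlineRStar 8 (8 * n + 1) : ℤ) = coeff n series81 := by
  rw [← coeff_two_mul_of_eq series41_eq, ← coeff_series41]
  ring_nf

theorem coeff_series83 (n : ℕ) : (overlineRStar 8 (8 * n + 3) : ℤ) = coeff n series83 := by
  rw [← coeff_two_mul_of_eq series43_eq, ← coeff_series43]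
  ring_nf

theorem coeff_series85 (n : ℕ) : (overlineRStar 8 (8 * n + 5) : ℤ) = coeff n series85 := by
  rw [← coeff_two_mul_add_one_of_eq series41_eq, ← coeff_series41]
  ring_nf

theorem coeff_series87 (n : ℕ) : (overlineRStar 8 (8 * n + 7) : ℤ) = coeff n series87 := by
  rw [← coeff_two_mul_add_one_of_eq series43_eq, ← coeff_series43]
  ring_nf

theorem coeff_series165 (n : ℕ) : (overlineRStar 8 (16 * n + 5) : ℤ) = coeff n series165 := by
  rw [← coeff_two_mul_of_eq series85_eq, ← coeff_series85]
  ring_nf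

theorem coeff_series1613 (n : ℕ) : (overlineRStar 8 (16 * n + 13) : ℤ) = coeff n series1613 := by
  rw [← coeff_two_mul_add_one_of_eq series85_eq, ← coeff_series85]
  ring_nf

theorem coeff_series3221 (n : ℕ) : (overlineRStar 8 (32 * n + 21) : ℤ) = coeff n series3221 := by
  rw [← coeff_two_mul_add_one_of_eq series165_eq, ← coeff_series165]
  ring_nf

theorem dvd_overlineRStar_sixteen_mul_add_nine (n : ℕ) :
    (8 : ℤ) ∣ overlineRStar 8 (16 * n + 9) := by
  rw [show 16 * n + 9 = 8 * (2 * n + 1) + 1 by ring, coeff_series81, series81, mul_assoc, mul_assoc,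
    coeff_ofNat_mul]
  refine mul_dvd_mul (a := 2) (b := 2) (c := 4) dvd_rfl
    (dvd_coeff_two_mul_add_one 4 (g := eulerProd ^ 2) (fun Q _ π h => ?_) n)
  have h4 : (4 : Q) = 0 := mod_cast h
  have h8 : (8 : Q) = 0 := by linear_combination 2 * h4
  simp only [map_mul, map_add, map_pow, map_ofNat, map_phiSq_of_four π h4,
    map_overSeries_pow_eight_of_eight π h8]
  linear_combination 12 * π (dilate eulerProd) ^ 2 * π X * π psiTwoSq ^ 2 * h4

theorem dvd_overlineRStar_sixteen_mul_add_eleven (n : ℕ) :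
    (16 : ℤ) ∣ overlineRStar 8 (16 * n + 11) := by
  rw [show 16 * n + 11 = 8 * (2 * n + 1) + 3 by ring, coeff_series83, series83, mul_assoc,
    mul_assoc, mul_assoc, coeff_ofNat_mul]
  refine mul_dvd_mul (a := 8) (b := 8) (c := 2) dvd_rfl
    (dvd_coeff_two_mul_add_one 2 (g := eulerProd ^ 2 * psi) (fun Q _ π h => ?_) n)
  have h2 : (2 : Q) = 0 := mod_cast h
  have h4 : (4 : Q) = 0 := by linear_combination 2 * h2
  have h8 : (8 : Q) = 0 := by linear_combination 4 * h2
  simp only [map_mul, map_add, map_pow, map_ofNat, map_phiSq_of_four π h4,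
    map_overSeries_pow_eight_of_eight π h8, map_psi_sq_of_two π h2]
  linear_combination 8 * π (dilate eulerProd) ^ 2 * π (dilate psi) * π X * π psiTwoSq ^ 2 * h2

theorem dvd_overlineRStar_thirtyTwo_mul_add_twentyFive (n : ℕ) :
    (16 : ℤ) ∣ overlineRStar 8 (32 * n + 25) := by
  rw [show 32 * n + 25 = 8 * (2 * (2 * n + 1) + 1) + 1 by ring, coeff_series81, series81,
    mul_assoc, mul_assoc, coeff_ofNat_mul]
  suffices h : (8 : ℤ) ∣ _ from mul_dvd_mul (a := 2) (b := 2) dvd_rfl h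
  -- Modulo 8, `W⁸ ≡ 1` and `48 ≡ 0`, while `A³ ≡ A(q²)³ + 4q A(q²)² B(q²)` because `12 ≡ 4`. The
  -- odd part thus supplies 4, and its cofactor must supply the last 2.
  have key := coeff_modEq 8 (f := dilate eulerProd ^ 2 *
      (overSeries ^ 8 * (phiSq ^ 3 + 48 * X * phiSq * psiTwoSq ^ 2)))
    (g := dilate (eulerProd ^ 2 * phiSq ^ 3) +
      X * dilate (4 * (eulerProd ^ 2 * phiSq ^ 2 * psiTwoSq))) (fun Q _ π h => by
      have h8 : (8 : Q) = 0 := mod_cast h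
      have hp := congrArg π phiSq_eq
      simp only [map_mul, map_add, map_pow, map_ofNat, map_overSeries_pow_eight_of_eight π h8]
        at hp ⊢
      generalize π (dilate phiSq) = A at hp ⊢
      generalize π (dilate psiTwoSq) = B at hp ⊢
      rw [hp]
      linear_combination (π (dilate eulerProd) ^ 2 * (6 * π X * (A + 4 * π X * B) * π psiTwoSq ^ 2
        + π X * A ^ 2 * B + 6 * π X ^ 2 * A * B ^ 2 + 8 * π X ^ 3 * B ^ 3)) * h8)
    (2 * (2 * n + 1) + 1)
  rw [coeff_two_mul_add_one_of_eq rfl, coeff_ofNat_mul] at key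
  refine (Int.ModEq.dvd_iff key).2 ?_
  refine mul_dvd_mul (a := 4) (b := 4) (c := 2) dvd_rfl
    (dvd_coeff_two_mul_add_one 2 (g := eulerProd * psi ^ 2) (fun Q _ π h => ?_) n)
  have h2 : (2 : Q) = 0 := mod_cast h
  have h4 : (4 : Q) = 0 := by linear_combination 2 * h2
  simp only [map_mul, map_pow, map_phiSq_of_four π h4, map_eulerProd_sq_of_two π h2, psiTwoSq]
  ring

theorem dvd_overlineRStar_sixtyFour_mul_add_thirtySeven (n : ℕ) :
    (32 : ℤ) ∣ overlineRStar 8 (64 * n + 37) := by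
  rw [show 64 * n + 37 = 16 * (2 * (2 * n + 1)) + 5 by ring, coeff_series165, series165,
    mul_assoc, mul_assoc, coeff_ofNat_mul]
  suffices h : (4 : ℤ) ∣ _ from mul_dvd_mul (a := 8) (b := 8) dvd_rfl h
  -- Modulo 4 only `3 f₂⁴` survives; its even part `3 f₁⁴ ≡ 3 f₂²` is again a series in `q²`.
  have key := coeff_modEq 4 (f := dilate eulerProd ^ 4 * (overSeries ^ 16 *
      (3 * phiSq ^ 6 + 976 * X * phiSq ^ 4 * psiTwoSq ^ 2 +
      15616 * X ^ 2 * phiSq ^ 2 * psiTwoSq ^ 4 + 12288 * X ^ 3 * psiTwoSq ^ 6)))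
    (g := dilate (3 * eulerProd ^ 4)) (fun Q _ π h => by
      have h4 : (4 : Q) = 0 := mod_cast h
      have h8 : (8 : Q) = 0 := by linear_combination 2 * h4
      simp only [map_mul, map_add, map_pow, map_ofNat, map_overSeries_pow_sixteen_of_eight π h8,
        map_phiSq_of_four π h4]
      linear_combination π (dilate eulerProd) ^ 4 * (244 * π X * π psiTwoSq ^ 2 +
        3904 * π X ^ 2 * π psiTwoSq ^ 4 + 3072 * π X ^ 3 * π psiTwoSq ^ 6) * h4)
    (2 * (2 * n + 1))
  rw [coeff_dilate_two_mul] at key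
  refine (Int.ModEq.dvd_iff key).2 ?_
  refine dvd_coeff_two_mul_add_one 4 (g := 3 * eulerProd ^ 2) (fun Q _ π h => ?_) n
  have h4 : (4 : Q) = 0 := mod_cast h
  simp only [map_mul, map_pow, map_ofNat, map_eulerProd_pow_four_of_four π h4]

theorem dvd_overlineRStar_sixteen_mul_add_thirteen (n : ℕ) :
    (64 : ℤ) ∣ overlineRStar 8 (16 * n + 13) := by
  rw [coeff_series1613, series1613, mul_assoc, mul_assoc, mul_assoc, coeff_ofNat_mul]
  exact dvd_mul_right _ _

theorem dvd_overlineRStar_sixteen_mul_add_fifteen (n : ℕ) :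
    (128 : ℤ) ∣ overlineRStar 8 (16 * n + 15) := by
  rw [show 16 * n + 15 = 8 * (2 * n + 1) + 7 by ring, coeff_series87, series87, mul_assoc,
    mul_assoc, mul_assoc, mul_assoc, coeff_ofNat_mul]
  refine mul_dvd_mul (a := 64) (b := 64) (c := 2) dvd_rfl
    (dvd_coeff_two_mul_add_one 2 (g := eulerProd ^ 2 * psi ^ 3) (fun Q _ π h => ?_) n)
  have h2 : (2 : Q) = 0 := mod_cast h
  have h4 : (4 : Q) = 0 := by linear_combination 2 * h2
  have h8 : (8 : Q) = 0 := by linear_combination 4 * h2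
  simp only [map_mul, map_pow, map_phiSq_of_four π h4, psiTwoSq,
    map_overSeries_pow_eight_of_eight π h8, map_psi_sq_of_two π h2]
  ring

theorem dvd_overlineRStar_thirtyTwo_mul_add_twentyNine (n : ℕ) :
    (256 : ℤ) ∣ overlineRStar 8 (32 * n + 29) := by
  rw [show 32 * n + 29 = 16 * (2 * n + 1) + 13 by ring, coeff_series1613, series1613, mul_assoc,
    mul_assoc, mul_assoc, coeff_ofNat_mul]
  refine mul_dvd_mul (a := 64) (b := 64) (c := 4) dvd_rfl
    (dvd_coeff_two_mul_add_one 4 (g := 11 * eulerProd ^ 4 * psi ^ 2) (fun Q _ π h => ?_) n)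
  have h4 : (4 : Q) = 0 := mod_cast h
  have h8 : (8 : Q) = 0 := by linear_combination 2 * h4
  simp only [map_mul, map_add, map_pow, map_ofNat, map_phiSq_of_four π h4, psiTwoSq,
    map_overSeries_pow_sixteen_of_eight π h8]
  linear_combination π (dilate eulerProd) ^ 4 * (168 * π X * π (dilate psi) ^ 6 +
    704 * π X ^ 2 * π (dilate psi) ^ 10) * h4

/-- The series `series3221 / 64`. -/
noncomputable def reducedSeries3221 : ℤ⟦X⟧ :=
  dilate (dilate eulerProd ^ 4) * dilate overSeries ^ 60 *
    (143 * phiSq ^ 28 + 217184 * X * phiSq ^ 26 * psiTwoSq ^ 2 +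
      64 * (phiSq ^ 16 * (498564 * X ^ 2 * phiSq ^ 8 * psiTwoSq ^ 4 +
      15844608 * X ^ 3 * phiSq ^ 6 * psiTwoSq ^ 6 +
      127632384 * X ^ 4 * phiSq ^ 4 * psiTwoSq ^ 8 +
      222396416 * X ^ 5 * phiSq ^ 2 * psiTwoSq ^ 10 +
      37486592 * X ^ 6 * psiTwoSq ^ 12)))

/-- Combining `f₁⁴ W² = f₂²`, `W³⁰ = A¹⁵ W(q²)⁶⁰` and `f₂² B = f₄⁴` turns the prefactor into a
series in `q²` times `A¹⁵`. The high power of `A` is what yields the large moduli. -/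
theorem series3221_eq : series3221 = 64 * reducedSeries3221 := by
  have h1 : eulerProd ^ 4 * overSeries ^ 2 = dilate eulerProd ^ 2 := by
    rw [← overSeries_mul_sq]
    ring
  have h2 : overSeries ^ 30 = phiSq ^ 15 * dilate overSeries ^ 60 := by
    rw [show 30 = 2 * 15 from rfl, pow_mul, overSeries_sq]
    ring
  have h3 : eulerProd ^ 4 * overSeries ^ 32 * psiTwoSq =
      dilate (dilate eulerProd ^ 4) * dilate overSeries ^ 60 * phiSq ^ 15 := by
    rw [← dilate_eulerProd_sq_mul_psiTwoSq, ← h1, show 32 = 2 + 30 from rfl, pow_add, h2]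
    ring
  rw [series3221, reducedSeries3221]
  linear_combination (8 * phiSq * (1144 * phiSq ^ 12 + 1737472 * X * phiSq ^ 10 * psiTwoSq ^ 2 +
      255264768 * X ^ 2 * phiSq ^ 8 * psiTwoSq ^ 4 +
      8112439296 * X ^ 3 * phiSq ^ 6 * psiTwoSq ^ 6 +
      65347780608 * X ^ 4 * phiSq ^ 4 * psiTwoSq ^ 8 +
      113866964992 * X ^ 5 * phiSq ^ 2 * psiTwoSq ^ 10 +
      19193135104 * X ^ 6 * psiTwoSq ^ 12)) * h3

theorem coeff_reducedSeries3221 (n : ℕ) :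
    (overlineRStar 8 (32 * n + 21) : ℤ) = 64 * coeff n reducedSeries3221 := by
  rw [coeff_series3221, series3221_eq, coeff_ofNat_mul]

theorem dvd_overlineRStar_thirtyTwo_mul_add_twentyOne (n : ℕ) :
    (64 : ℤ) ∣ overlineRStar 8 (32 * n + 21) := by
  rw [coeff_reducedSeries3221]
  exact dvd_mul_right _ _

theorem dvd_overlineRStar_sixtyFour_mul_add_fiftyThree (n : ℕ) :
    (1024 : ℤ) ∣ overlineRStar 8 (64 * n + 53) := by
  rw [show 64 * n + 53 = 32 * (2 * n + 1) + 21 by ring, coeff_reducedSeries3221]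
  refine mul_dvd_mul (a := 64) (b := 64) (c := 16) dvd_rfl
    (dvd_coeff_two_mul_add_one 16 (g := 143 * dilate eulerProd ^ 4 * overSeries ^ 60)
      (fun Q _ π h => ?_) n)
  have h16 : (16 : Q) = 0 := mod_cast h
  have h64 : (64 : Q) = 0 := by linear_combination 4 * h16
  have hp : π phiSq ^ 28 = 1 := by
    rw [pow_mul _ 4 7, map_phiSq_pow_four_of_sixteen π h16, one_pow]
  simp only [reducedSeries3221, map_mul, map_add, map_pow, map_ofNat, hp, h64]
  linear_combination π (dilate (dilate eulerProd)) ^ 4 * π (dilate overSeries) ^ 60 *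
    (13574 * π X * π phiSq ^ 26 * π psiTwoSq ^ 2) * h16

theorem dvd_overlineRStar_oneHundredTwentyEight_mul_add_eightyFive (n : ℕ) :
    (512 : ℤ) ∣ overlineRStar 8 (128 * n + 85) := by
  rw [show 128 * n + 85 = 32 * (2 * (2 * n + 1)) + 21 by ring, coeff_reducedSeries3221]
  suffices h : (8 : ℤ) ∣ _ from mul_dvd_mul (a := 64) (b := 64) dvd_rfl h
  have key := coeff_modEq 8 (f := reducedSeries3221)
    (g := dilate (143 * dilate eulerProd ^ 4 * overSeries ^ 60)) (fun Q _ π h => by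
      have h8 : (8 : Q) = 0 := mod_cast h
      have h64 : (64 : Q) = 0 := by linear_combination 8 * h8
      have hp : π phiSq ^ 28 = 1 := by
        rw [pow_mul _ 2 14, map_phiSq_sq_of_eight π h8, one_pow]
      simp only [reducedSeries3221, map_mul, map_add, map_pow, map_ofNat, hp, h64]
      linear_combination π (dilate (dilate eulerProd)) ^ 4 * π (dilate overSeries) ^ 60 *
        (27148 * π X * π phiSq ^ 26 * π psiTwoSq ^ 2) * h8)
    (2 * (2 * n + 1))
  rw [coeff_dilate_two_mul] at key
  refine (Int.ModEq.dvd_iff key).2 ?_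
  refine dvd_coeff_two_mul_add_one 8 (g := 143 * eulerProd ^ 4) (fun Q _ π h => ?_) n
  have h8 : (8 : Q) = 0 := mod_cast h
  simp only [map_mul, map_pow, map_ofNat, map_overSeries_pow_sixty_of_eight π h8, mul_one]

/-- In the binomial expansion every term from the cube of `4xB` on is divisible by 64; the others
have coefficients 1, `28 · 4` and `378 · 16`. -/
theorem add_mul_pow_twentyEight {Q : Type*} [CommRing Q] (h64 : (64 : Q) = 0) (A B x : Q) :
    (A + 4 * x * B) ^ 28 =
      A ^ 28 + 6048 * x ^ 2 * A ^ 26 * B ^ 2 + x * (112 * A ^ 27 * B) := by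
  have h4 : (A + 4 * x * B) ^ 4 = A ^ 4 + 16 * (x * A ^ 3 * B + 2 * x ^ 2 * A ^ 2 * B ^ 2) := by
    linear_combination (x ^ 2 * A ^ 2 * B ^ 2 + 4 * x ^ 3 * A * B ^ 3 + 4 * x ^ 4 * B ^ 4) * h64
  have h7 : ∀ a b : Q, (a + 16 * b) ^ 7 = a ^ 7 + 112 * a ^ 6 * b := fun a b => by
    linear_combination (84 * a ^ 5 * b ^ 2 + 2240 * a ^ 4 * b ^ 3 + 35840 * a ^ 3 * b ^ 4 +
      344064 * a ^ 2 * b ^ 5 + 1835008 * a * b ^ 6 + 4194304 * b ^ 7) * h64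
  rw [pow_mul _ 4 7, h4, h7]
  linear_combination -91 * x ^ 2 * A ^ 26 * B ^ 2 * h64

theorem dvd_overlineRStar_oneHundredTwentyEight_mul_add_oneHundredSeventeen (n : ℕ) :
    (4096 : ℤ) ∣ overlineRStar 8 (128 * n + 117) := by
  rw [show 128 * n + 117 = 32 * (2 * (2 * n + 1) + 1) + 21 by ring, coeff_reducedSeries3221]
  suffices h : (64 : ℤ) ∣ _ from mul_dvd_mul (a := 64) (b := 64) dvd_rfl h
  -- The odd part has coefficient `143 · 112 + 32 = 16 · 1003`, where `32 ≡ 217184 (mod 64)`.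
  have key := coeff_modEq 64 (f := reducedSeries3221)
    (g := dilate (143 * dilate eulerProd ^ 4 * overSeries ^ 60 *
        (phiSq ^ 28 + 6048 * X * phiSq ^ 26 * psiTwoSq ^ 2)) +
      X * dilate (16 * (dilate eulerProd ^ 4 * overSeries ^ 60 *
        (1003 * phiSq ^ 27 * psiTwoSq)))) (fun Q _ π h => by
      have h64 : (64 : Q) = 0 := mod_cast h
      have hp := congrArg π phiSq_eq
      have hz := congrArg π psiTwoSq_sq
      have h28 := add_mul_pow_twentyEight h64 (π (dilate phiSq)) (π (dilate psiTwoSq)) (π X)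
      -- Knowing `A²⁶` modulo 4 suffices, because its coefficient 217184 is divisible by 16.
      obtain ⟨v, hv⟩ : ∃ v, π phiSq ^ 26 = π (dilate phiSq) ^ 26 + 4 * v := by
        obtain ⟨w, hw⟩ := sub_dvd_pow_sub_pow (π phiSq) (π (dilate phiSq)) 26
        refine ⟨π X * π (dilate psiTwoSq) * w, ?_⟩
        simp only [map_mul, map_add, map_ofNat] at hp
        linear_combination hw + w * hp
      simp only [reducedSeries3221, map_mul, map_add, map_pow, map_ofNat, dilate_X, h64] at hp hz ⊢
      rw [← hp] at h28
      rw [hv, h28, hz]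
      linear_combination π (dilate (dilate eulerProd)) ^ 4 * π (dilate overSeries) ^ 60 *
        (π X * π (dilate phiSq) * π (dilate psiTwoSq) *
          (13574 * v + 3393 * π (dilate phiSq) ^ 26)) * h64)
    (2 * (2 * n + 1) + 1)
  rw [coeff_two_mul_add_one_of_eq rfl, coeff_ofNat_mul] at key
  refine (Int.ModEq.dvd_iff key).2 ?_
  refine mul_dvd_mul (a := 16) (b := 16) (c := 4) dvd_rfl
    (dvd_coeff_two_mul_add_one 4 (g := 1003 * eulerProd ^ 4 * psi ^ 2) (fun Q _ π h => ?_) n)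
  have h4 : (4 : Q) = 0 := mod_cast h
  have h8 : (8 : Q) = 0 := by linear_combination 2 * h4
  simp only [map_mul, map_pow, map_ofNat, map_phiSq_of_four π h4, psiTwoSq,
    map_overSeries_pow_sixty_of_eight π h8]
  ring

end Overpartition

open Overpartition in
theorem theorem1p6 (n : ℕ) :
    overlineRStar 8 (16 * n + 9) ≡ 0 [MOD 8] ∧
    overlineRStar 8 (16 * n + 11) ≡ 0 [MOD 16] ∧
    overlineRStar 8 (32 * n + 25) ≡ 0 [MOD 16] ∧
    overlineRStar 8 (64 * n + 37) ≡ 0 [MOD 32] ∧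
    overlineRStar 8 (16 * n + 13) ≡ 0 [MOD 64] ∧
    overlineRStar 8 (32 * n + 21) ≡ 0 [MOD 64] ∧
    overlineRStar 8 (16 * n + 15) ≡ 0 [MOD 128] ∧
    overlineRStar 8 (32 * n + 29) ≡ 0 [MOD 256] ∧
    overlineRStar 8 (128 * n + 85) ≡ 0 [MOD 512] ∧
    overlineRStar 8 (64 * n + 53) ≡ 0 [MOD 1024] ∧
    overlineRStar 8 (128 * n + 117) ≡ 0 [MOD 4096] := by
  simp only [Nat.modEq_zero_iff_dvd]
  zify
  exact ⟨dvd_overlineRStar_sixteen_mul_add_nine n, dvd_overlineRStar_sixteen_mul_add_eleven n,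
    dvd_overlineRStar_thirtyTwo_mul_add_twentyFive n,
    dvd_overlineRStar_sixtyFour_mul_add_thirtySeven n,
    dvd_overlineRStar_sixteen_mul_add_thirteen n,
    dvd_overlineRStar_thirtyTwo_mul_add_twentyOne n,
    dvd_overlineRStar_sixteen_mul_add_fifteen n,
    dvd_overlineRStar_thirtyTwo_mul_add_twentyNine n,
    dvd_overlineRStar_oneHundredTwentyEight_mul_add_eightyFive n,
    dvd_overlineRStar_sixtyFour_mul_add_fiftyThree n,
    dvd_overlineRStar_oneHundredTwentyEight_mul_add_oneHundredSeventeen n⟩
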